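/- Let $m\ge 2$ and consider the $m$-user symmetric binary random access channel (BD-RAC): inputs are bits, and when $A\subseteq\{1,\dots,m\}$, $A\neq\emptyset$, is the set of active users, the receiver observes $Y_{A,t}=\sum_{a\in A}X_{a,t}$ over $\mathrm{GF}(2)$ at times $t=1,\dots,n$. A message structure $\mathscr W$ consists of finite sets $\mathcal W_i=\{W_{i,1},\dots,W_{i,|\mathcal W_i|}\}$ of messages, one for each user $i$, and of sets $\mathcal W_i(A)\subseteq\mathcal W_i$ for $i\in A\subseteq\{1,\dots,m\}$, with $\mathcal W_i(B)\subseteq\mathcal W_i(A)$ whenever $i\in A\subseteq B$. Given rates $R_{i,j}\ge 0$, the messages are independent, $W_{i,j}$ being uniform on a set of $\lceil 2^{nR_{i,j}}\rceil$ elements. In an $n$-code, encoder $i$ maps the messages of user $i$ to a codeword in $\{0,1\}^n$, and decoder $A$ estimates, from $(Y_{A,t})_{t\le n}$, all messages in $\bigcup_{i\in A}\mathcal W_i(A)$; its error probability is the probability that at least one of these estimates is wrong. The rates $(R_{i,j})$ are achievable for $\mathscr W$ if some sequence of $n$-codes has error probability tending to $0$ as $n\to\infty$ at every decoder $A$; then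 the tuple $(r_i(A))_{i\in A}$ with $r_i(A)=\sum_{j:\,W_{i,j}\in\mathcal W_i(A)}R_{i,j}$ is called achievable for $\mathscr W$. Let $\mathcal C_{\mathscr W}$ be the closure of the set of tuples achievable for $\mathscr W$, and let the capacity region be $\mathcal C=\overline{\bigcup_{\mathscr W}\mathcal C_{\mathscr W}}$. Put $\rho_k=\sum_{|A|=k}\sum_{i\in A}r_i(A)$ for $k=1,\dots,m$, and let $\mathcal P\subset\mathbb R^m$ be the set of all $(\rho_1,\dots,\rho_m)$ with $$\frac{\rho_1}{1\cdot\binom m1}\ \ge\ \frac{\rho_2}{2\binom m2}\ \ge\ \dots\ \ge\ \frac{\rho_m}{m\binom mm}\ \ge\ 0,\qquad \sum_{k=1}^m\frac{\rho_k}{k\binom mk}\ \le\ 1 .$$ Theorem. The image of $\mathcal C$ under $(r_i(A))\mapsto(\rho_1,\dots,\rho_m)$ is exactly $\mathcal P$. Moreover, let $\mathscr W^{\mathrm{lay}}$ be the layered message structure in which each user $i$ has $m$ messages $W_{i,1},\dots,W_{i,m}$ and $\mathcal W_i(A)=\{W_{i,j}: j\ge|A|\}$. Then: 1. The image of $\mathcal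 C_{\mathscr W^{\mathrm{lay}}}$ is also $\mathcal P$. 2. For every $k\in\{1,\dots,m\}$ and $0\le s<1/k$, the rates $R_{i,k}=s$, $R_{i,j}=0$ $(j\ne k)$, for all $i$, are achievable for $\mathscr W^{\mathrm{lay}}$. The tuple $r^{(k)}$ obtained for $s=1/k$, namely $r^{(k)}_i(A)=1/k$ if $|A|\le k$ and $0$ otherwise, lies in $\mathcal C_{\mathscr W^{\mathrm{lay}}}$. 3. $\mathcal P$ is the convex hull of $0$ and the images of $r^{(1)},\dots,r^{(m)}$. -/

import Mathlib

open Filter Topology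

namespace BDRAC

/-- A message structure for `m` users. User `i` has the finitely many messages
`W_{i,j}`, `j : Fin (numMsg i)`; `decoded A i` is the set of (indices of) the messages of user
`i ∈ A` that have to be decoded when `A` is the set of active users. -/
structure MessageStructure (m : ℕ) where
  numMsg : Fin m → ℕ
  decoded : (A : Finset (Fin m)) → (i : A) → Finset (Fin (numMsg i))
  /-- What is decoded in a state `B` is decoded in every smaller state `A ⊆ B`. -/
  decoded_anti : ∀ (A B : Finset (Fin m)) (h : A ⊆ B) (i : A),
    decoded B ⟨i, h i.2⟩ ⊆ decoded A i

/-- Microscopic rates: the rate `R_{i,j}` of each message. -/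
abbrev MessageStructure.Rates {m : ℕ} (W : MessageStructure m) : Type :=
  (i : Fin m) → Fin (W.numMsg i) → ℝ

/-- The number `⌈2 ^ (n R)⌉` of values of a message of rate `R` at block length `n`. -/
noncomputable def msgCard (n : ℕ) (R : ℝ) : ℕ := ⌈(2 : ℝ) ^ ((n : ℝ) * R)⌉₊

/-- The possible values of all the messages of user `i`. -/
abbrev UserMsg {m : ℕ} (W : MessageStructure m) (R : W.Rates) (n : ℕ) (i : Fin m) : Type :=
  (j : Fin (W.numMsg i)) → Fin (msgCard n (R i j))

/-- An `n`-code for the symmetric BD-RAC, whose input and output alphabets are `GF(2)`. Encoder `i`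
sees the messages of user `i` only. Decoder `A` sees the output sequence in state `A` and estimates
the messages that are to be decoded there (for `A = ∅` there is nothing to estimate). -/
structure Code {m : ℕ} (W : MessageStructure m) (R : W.Rates) (n : ℕ) where
  enc : (i : Fin m) → UserMsg W R n i → (Fin n → ZMod 2)
  dec : (A : Finset (Fin m)) → (Fin n → ZMod 2) →
    (i : A) → (j : W.decoded A i) → Fin (msgCard n (R i j))

/-- The noise-free channel: in state `A`, the output at time `t` is the sum over `GF(2)` of the
inputs at time `t` of the users in `A`. -/
def channelOut {m n : ℕ} (A : Finset (Fin m)) (x : Fin m → Fin n → ZMod 2) : Fin n → ZMod 2 :=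
  fun t => ∑ a ∈ A, x a t

/-- Decoder `A` makes an error on the messages `w`: some message that it has to decode is
estimated wrongly. -/
def Code.IsError {m : ℕ} {W : MessageStructure m} {R : W.Rates} {n : ℕ} (c : Code W R n)
    (A : Finset (Fin m)) (w : (i : Fin m) → UserMsg W R n i) : Prop :=
  ∃ (i : A) (j : W.decoded A i),
    c.dec A (channelOut A fun a => c.enc a (w a)) i j ≠ w i j

/-- The average probability of error of decoder `A`. The messages are independent and uniformly
distributed, so it is the proportion of message vectors on which an error occurs. -/
noncomputable def Code.errorProb {m : ℕ} {W : MessageStructure m} {R : W.Rates} {n : ℕ}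
    (c : Code W R n) (A : Finset (Fin m)) : ℝ :=
  (Nat.card {w : (i : Fin m) → UserMsg W R n i // c.IsError A w} : ℝ) /
    (Nat.card ((i : Fin m) → UserMsg W R n i) : ℝ)

/-- The messages can be sent at the rates `R`: these are non-negative, and some sequence of
`n`-codes has vanishing error probability at every receiver. -/
def MessageStructure.RatesAchievable {m : ℕ} (W : MessageStructure m) (R : W.Rates) : Prop :=
  (∀ i j, 0 ≤ R i j) ∧
    ∃ c : (n : ℕ) → Code W R n, ∀ A : Finset (Fin m), A.Nonempty →
      Tendsto (fun n => (c n).errorProb A) atTop (𝓝 0)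

/-- Macroscopic rate tuples: `r A i` is the rate `r_i(A)`, `i ∈ A`. -/
abbrev RateTuple (m : ℕ) : Type := (A : Finset (Fin m)) → A → ℝ

/-- `r_i(A)` is the sum of the rates of the messages of user `i` that are decoded in state `A`. -/
def MessageStructure.rateTuple {m : ℕ} (W : MessageStructure m) (R : W.Rates) : RateTuple m :=
  fun A i => ∑ j ∈ W.decoded A i, R i j

/-- The capacity region for a given message structure. -/
def MessageStructure.capacityRegion {m : ℕ} (W : MessageStructure m) : Set (RateTuple m) :=
  closure {r | ∃ R : W.Rates, W.RatesAchievable R ∧ r = W.rateTuple R}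

/-- The capacity region of the `m`-user symmetric BD-RAC. -/
def capacityRegion (m : ℕ) : Set (RateTuple m) :=
  closure (⋃ W : MessageStructure m, W.capacityRegion)

/-- `(ρ_1, …, ρ_m)`; the entry at `k : Fin m` is `ρ_{k+1}`, the sum of `r_i(A)` over all `A` with
`k + 1` elements and all `i ∈ A`. -/
def rho {m : ℕ} (r : RateTuple m) : Fin m → ℝ :=
  fun k => ∑ A ∈ (Finset.univ : Finset (Fin m)).powersetCard ((k : ℕ) + 1), ∑ i : A, r A i

/-- `ρ_{k+1} / ((k+1) * C(m, k+1))` -/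
noncomputable def normalized {m : ℕ} (ρ : Fin m → ℝ) (k : Fin m) : ℝ :=
  ρ k / (((k : ℕ) + 1 : ℝ) * (m.choose ((k : ℕ) + 1) : ℝ))

/-- The polytope of the `ρ` whose normalized entries are non-increasing, non-negative, and have
sum at most `1`. -/
def polytope (m : ℕ) : Set (Fin m → ℝ) :=
  {ρ | Antitone (normalized ρ) ∧ (∀ k, 0 ≤ normalized ρ k) ∧ ∑ k, normalized ρ k ≤ 1}

/-- The layered message structure: each user has `m` messages, and the `j`-th one (index `j - 1`)
is decoded exactly when at most `j` users are active. -/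
def layered (m : ℕ) : MessageStructure m where
  numMsg := fun _ => m
  decoded := fun A _ => {j : Fin m | A.card ≤ (j : ℕ) + 1}
  decoded_anti := by
    intro A B h i j hj
    simp only [Finset.mem_filter, Finset.mem_univ, true_and] at hj ⊢
    exact (Finset.card_le_card h).trans hj

/-- Only the message of layer `k` (index `k - 1`) of each user carries information, at rate `s`. -/
def singleLayerRates (m : ℕ) (k : Fin m) (s : ℝ) : (layered m).Rates :=
  fun _ j => if (j : ℕ) = (k : ℕ) then s else 0

end BDRAC

namespace BDRAC

theorem one_le_msgCard (n : ℕ) (R : ℝ) : 1 ≤ msgCard n R :=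
  Nat.one_le_ceil_iff.2 (by positivity)

instance (n : ℕ) (R : ℝ) : NeZero (msgCard n R) := ⟨Nat.one_le_iff_ne_zero.1 (one_le_msgCard n R)⟩

/-! ### Averaging over permutations -/

/-- The rate `r_i(A)`, extended by zero to users that are not active. -/
noncomputable def RateTuple.ext {m : ℕ} (r : RateTuple m) (A : Finset (Fin m)) (i : Fin m) : ℝ :=
  if h : i ∈ A then r A ⟨i, h⟩ else 0

/-- The pairs of a set with `k` elements and one of its elements. -/
def pointedSets (m k : ℕ) : Finset (Finset (Fin m) × Fin m) :=
  {p | p.1.card = k ∧ p.2 ∈ p.1}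

theorem sum_pointedSets {m k : ℕ} (f : Finset (Fin m) × Fin m → ℝ) :
    ∑ p ∈ pointedSets m k, f p =
      ∑ A ∈ (Finset.univ : Finset (Fin m)).powersetCard k, ∑ i ∈ A, f (A, i) := by
  rw [Finset.sum_sigma']
  refine Finset.sum_bij' (fun p _ => ⟨p.1, p.2⟩) (fun p _ => (p.1, p.2)) ?_ ?_ ?_ ?_ ?_ <;>
    simp [pointedSets, Finset.mem_powersetCard]

theorem card_pointedSets (m k : ℕ) : ((pointedSets m k).card : ℝ) = k * m.choose k := by
  have h := sum_pointedSets (m := m) (k := k) (fun _ => 1)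
  simp only [Finset.sum_const, nsmul_eq_mul, mul_one] at h
  rw [h, Finset.sum_congr rfl (g := fun _ => (k : ℝ))
    (fun A hA => by rw [(Finset.mem_powersetCard.1 hA).2])]
  simp [mul_comm]

theorem rho_eq_sum {m : ℕ} (r : RateTuple m) (k : Fin m) :
    rho r k = ∑ p ∈ pointedSets m (k + 1), r.ext p.1 p.2 := by
  rw [sum_pointedSets, rho]
  refine Finset.sum_congr rfl fun A _ => ?_
  rw [← Finset.sum_coe_sort A]
  exact Finset.sum_congr rfl fun i _ => by simp [RateTuple.ext]

theorem exists_perm_map_eq {α : Type*} [Fintype α] [DecidableEq α] {A B : Finset α} {a b : α}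
    (hAB : A.card = B.card) (ha : a ∈ A) (hb : b ∈ B) :
    ∃ σ : Equiv.Perm α, A.map σ.toEmbedding = B ∧ σ a = b := by
  let e : {x // x ∈ A} ≃ {x // x ∈ B} := Finset.equivOfCardEq hAB
  let e' := e.trans (Equiv.swap (e ⟨a, ha⟩) ⟨b, hb⟩)
  refine ⟨e'.extendSubtype, ?_, ?_⟩
  · refine Finset.eq_of_subset_of_card_le (fun y hy => ?_) (by simp [hAB])
    obtain ⟨x, hx, rfl⟩ := Finset.mem_map.1 hy
    exact e'.extendSubtype_mem x hx
  · rw [Equiv.extendSubtype_apply_of_mem _ _ ha]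
    simp [e']

theorem sum_perm_eq {m k : ℕ} (f : Finset (Fin m) × Fin m → ℝ) {A : Finset (Fin m)} {i : Fin m}
    (hA : A.card = k) (hi : i ∈ A) :
    (pointedSets m k).card * ∑ σ : Equiv.Perm (Fin m), f (A.map σ.toEmbedding, σ i) =
      Fintype.card (Equiv.Perm (Fin m)) * ∑ p ∈ pointedSets m k, f p := by
  have h1 : ∀ p ∈ pointedSets m k, ∑ σ : Equiv.Perm (Fin m), f (p.1.map σ.toEmbedding, σ p.2) =
      ∑ σ : Equiv.Perm (Fin m), f (A.map σ.toEmbedding, σ i) := by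
    rintro ⟨B, j⟩ hp
    simp only [pointedSets, Finset.mem_filter, Finset.mem_univ, true_and] at hp
    obtain ⟨τ, rfl, rfl⟩ := exists_perm_map_eq (hA.trans hp.1.symm) hi hp.2
    refine Fintype.sum_equiv (Equiv.mulRight τ) _ _ fun σ => ?_
    simp only [Finset.map_map]
    rfl
  have h2 : ∀ σ : Equiv.Perm (Fin m),
      ∑ p ∈ pointedSets m k, f (p.1.map σ.toEmbedding, σ p.2) = ∑ p ∈ pointedSets m k, f p := by
    intro σ
    refine Finset.sum_bij' (fun p _ => (p.1.map σ.toEmbedding, σ p.2))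
      (fun p _ => (p.1.map σ.symm.toEmbedding, σ.symm p.2)) ?_ ?_ ?_ ?_ ?_ <;>
      simp [pointedSets, Finset.map_map, Finset.map_refl]
  rw [← nsmul_eq_mul, ← Finset.sum_const, ← Finset.sum_congr rfl h1, Finset.sum_comm,
    Finset.sum_congr rfl (fun σ _ => h2 σ)]
  simp

theorem normalized_rho_eq {m : ℕ} (r : RateTuple m) (k : Fin m) {A : Finset (Fin m)} {i : Fin m}
    (hA : A.card = k + 1) (hi : i ∈ A) :
    normalized (rho r) k = (∑ σ : Equiv.Perm (Fin m), r.ext (A.map σ.toEmbedding) (σ i)) /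
      Fintype.card (Equiv.Perm (Fin m)) := by
  have h := sum_perm_eq (fun p => r.ext p.1 p.2) hA hi
  have hc := card_pointedSets m (k + 1)
  rw [← rho_eq_sum, hc] at h
  have h1 : 0 < m.choose (k + 1) := Nat.choose_pos k.2
  have h2 : 0 < Fintype.card (Equiv.Perm (Fin m)) := Fintype.card_pos
  rw [normalized]
  push_cast at h
  rw [div_eq_div_iff (by positivity) (by positivity)]
  linarith

/-! ### Converse -/

variable {m : ℕ}

theorem channelOut_add_compl {n : ℕ} (A : Finset (Fin m)) (x : Fin m → Fin n → ZMod 2) :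
    channelOut A x + channelOut Aᶜ x = channelOut Finset.univ x := by
  funext t
  exact Finset.sum_add_sum_compl A _

/-- The users whose rank is at most the rank of user `a`. -/
def upTo (σ : Equiv.Perm (Fin m)) (a : Fin m) : Finset (Fin m) := {b | σ b ≤ σ a}

theorem mem_upTo {σ : Equiv.Perm (Fin m)} {a b : Fin m} : b ∈ upTo σ a ↔ σ b ≤ σ a := by
  simp [upTo]

/-- The messages of user `a` that are decoded when the users up to `a` are active. -/
def chainDecoded (W : MessageStructure m) (σ : Equiv.Perm (Fin m)) (a : Fin m) :
    Finset (Fin (W.numMsg a)) :=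
  W.decoded (upTo σ a) ⟨a, mem_upTo.2 le_rfl⟩

theorem Code.eq_of_not_isError {W : MessageStructure m} {R : W.Rates} {n : ℕ} (c : Code W R n)
    (σ : Equiv.Perm (Fin m)) {w w' : (i : Fin m) → UserMsg W R n i}
    (hw : ∀ a, ¬ c.IsError (upTo σ a) w) (hw' : ∀ a, ¬ c.IsError (upTo σ a) w')
    (hY : channelOut Finset.univ (fun a => c.enc a (w a)) =
      channelOut Finset.univ (fun a => c.enc a (w' a)))
    (hG : ∀ a, ∀ j ∉ chainDecoded W σ a, w a j = w' a j) : w = w' := by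
  have key : ∀ k : Fin m, w (σ.symm k) = w' (σ.symm k) := by
    intro k
    induction k using WellFoundedGT.induction with
    | ind k ih =>
      set a := σ.symm k with ha
      have hout : channelOut (upTo σ a) (fun a => c.enc a (w a)) =
          channelOut (upTo σ a) (fun a => c.enc a (w' a)) := by
        rw [← channelOut_add_compl (upTo σ a), ← channelOut_add_compl (upTo σ a)] at hY
        have : channelOut (upTo σ a)ᶜ (fun a => c.enc a (w a)) =
            channelOut (upTo σ a)ᶜ (fun a => c.enc a (w' a)) := by
          funext t
          refine Finset.sum_congr rfl fun b hb => ?_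
          have hb' : k < σ b := by simpa [mem_upTo, ha] using hb
          have := ih (σ b) hb'
          rw [Equiv.symm_apply_apply] at this
          simp only [this]
        rw [this] at hY
        exact add_right_cancel hY
      funext j
      by_cases hj : j ∈ chainDecoded W σ a
      · have h1 := hw a
        have h2 := hw' a
        simp only [Code.IsError, not_exists, not_not] at h1 h2
        rw [← h1 ⟨a, mem_upTo.2 le_rfl⟩ ⟨j, hj⟩, ← h2 ⟨a, mem_upTo.2 le_rfl⟩ ⟨j, hj⟩, hout]
      · exact hG a j hj
  funext a
  have := key (σ a)
  rwa [Equiv.symm_apply_apply] at this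

theorem Code.card_noError_le {W : MessageStructure m} {R : W.Rates} {n : ℕ} (c : Code W R n)
    (σ : Equiv.Perm (Fin m)) :
    Nat.card {w : (i : Fin m) → UserMsg W R n i // ∀ a, ¬ c.IsError (upTo σ a) w} ≤
      2 ^ n * ∏ a, ∏ j ∈ (chainDecoded W σ a)ᶜ, msgCard n (R a j) := by
  let f : {w : (i : Fin m) → UserMsg W R n i // ∀ a, ¬ c.IsError (upTo σ a) w} →
      (Fin n → ZMod 2) ×
        ((a : Fin m) → (j : ((chainDecoded W σ a)ᶜ : Finset _)) → Fin (msgCard n (R a j))) :=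
    fun w => (channelOut Finset.univ (fun a => c.enc a (w.1 a)), fun a j => w.1 a j)
  have hf : Function.Injective f := by
    intro w w' h
    refine Subtype.ext (c.eq_of_not_isError σ w.2 w'.2 (congrArg Prod.fst h) fun a j hj => ?_)
    exact congrFun (congrFun (congrArg Prod.snd h) a) ⟨j, by simpa using hj⟩
  refine (Nat.card_le_card_of_injective f hf).trans_eq ?_
  rw [Nat.card_eq_fintype_card, Fintype.card_prod]
  simp only [Fintype.card_pi, Fintype.card_fin, ZMod.card, Finset.prod_const, Finset.card_univ]
  congr 1
  refine Finset.prod_congr rfl fun a _ => ?_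
  rw [← Finset.prod_coe_sort ((chainDecoded W σ a)ᶜ)]

theorem Code.one_sub_sum_errorProb_le {W : MessageStructure m} {R : W.Rates} {n : ℕ}
    (c : Code W R n) (σ : Equiv.Perm (Fin m)) :
    (1 - ∑ a, c.errorProb (upTo σ a)) * ∏ a, ∏ j ∈ chainDecoded W σ a, (msgCard n (R a j) : ℝ) ≤
      2 ^ n := by
  classical
  have hN : Nat.card ((i : Fin m) → UserMsg W R n i) =
      (∏ a, ∏ j ∈ chainDecoded W σ a, msgCard n (R a j)) *
        ∏ a, ∏ j ∈ (chainDecoded W σ a)ᶜ, msgCard n (R a j) := by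
    rw [← Finset.prod_mul_distrib, Nat.card_eq_fintype_card]
    simp only [Fintype.card_pi, Fintype.card_fin, Finset.prod_mul_prod_compl]
  have hpos : ∀ s : (a : Fin m) → Finset (Fin (W.numMsg a)),
      0 < ∏ a, ∏ j ∈ s a, msgCard n (R a j) := fun s =>
    Finset.prod_pos fun a _ => Finset.prod_pos fun j _ => one_le_msgCard _ _
  have hNpos : 0 < Nat.card ((i : Fin m) → UserMsg W R n i) := by
    rw [hN]; exact Nat.mul_pos (hpos _) (hpos _)
  have hcover : Nat.card ((i : Fin m) → UserMsg W R n i) ≤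
      Nat.card {w : (i : Fin m) → UserMsg W R n i // ∀ a, ¬ c.IsError (upTo σ a) w} +
        ∑ a, Nat.card {w : (i : Fin m) → UserMsg W R n i // c.IsError (upTo σ a) w} := by
    simp only [Nat.card_eq_fintype_card, Fintype.card_subtype]
    rw [← Finset.card_univ]
    refine le_trans (Finset.card_le_card fun w _ => ?_) ((Finset.card_union_le _
      (Finset.univ.biUnion fun a => {w | c.IsError (upTo σ a) w})).trans
      (Nat.add_le_add_left Finset.card_biUnion_le _))
    by_cases h : ∃ a, c.IsError (upTo σ a) w <;> simp_all
  have hle := hcover.trans (Nat.add_le_add_right (c.card_noError_le σ) _)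
  have hle' : (Nat.card ((i : Fin m) → UserMsg W R n i) : ℝ) ≤
      2 ^ n * (∏ a, ∏ j ∈ (chainDecoded W σ a)ᶜ, msgCard n (R a j) : ℕ) +
        ∑ a, (Nat.card {w : (i : Fin m) → UserMsg W R n i // c.IsError (upTo σ a) w} : ℝ) := by
    exact_mod_cast hle
  have hsum : ∑ a, c.errorProb (upTo σ a) =
      (∑ a, (Nat.card {w : (i : Fin m) → UserMsg W R n i // c.IsError (upTo σ a) w} : ℝ)) /
        (Nat.card ((i : Fin m) → UserMsg W R n i) : ℝ) := by
    rw [Finset.sum_div]; rfl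
  have hNr : (0 : ℝ) < Nat.card ((i : Fin m) → UserMsg W R n i) := by exact_mod_cast hNpos
  have hG : (0 : ℝ) < (∏ a, ∏ j ∈ (chainDecoded W σ a)ᶜ, msgCard n (R a j) : ℕ) := by
    exact_mod_cast hpos _
  have hN' : (Nat.card ((i : Fin m) → UserMsg W R n i) : ℝ) =
      (∏ a, ∏ j ∈ chainDecoded W σ a, (msgCard n (R a j) : ℝ)) *
        (∏ a, ∏ j ∈ (chainDecoded W σ a)ᶜ, msgCard n (R a j) : ℕ) := by
    rw [hN]; push_cast; rfl
  rw [hsum]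
  generalize (∑ a, (Nat.card {w : (i : Fin m) → UserMsg W R n i //
    c.IsError (upTo σ a) w} : ℝ)) = E at *
  generalize (Nat.card ((i : Fin m) → UserMsg W R n i) : ℝ) = N at *
  refine le_of_mul_le_mul_right ?_ hG
  rw [mul_assoc, ← hN', sub_mul, one_mul, div_mul_cancel₀ _ hNr.ne']
  linarith

theorem two_rpow_le_prod_msgCard {W : MessageStructure m} (R : W.Rates) (n : ℕ)
    (s : (a : Fin m) → Finset (Fin (W.numMsg a))) :
    (2 : ℝ) ^ ((n : ℝ) * ∑ a, ∑ j ∈ s a, R a j) ≤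
      ∏ a, ∏ j ∈ s a, (msgCard n (R a j) : ℝ) := by
  rw [Finset.mul_sum, Real.rpow_sum_of_pos two_pos]
  refine Finset.prod_le_prod (fun a _ => by positivity) fun a _ => ?_
  rw [Finset.mul_sum, Real.rpow_sum_of_pos two_pos]
  exact Finset.prod_le_prod (fun j _ => by positivity) fun j _ => Nat.le_ceil _

theorem MessageStructure.RatesAchievable.sum_chainDecoded_le_one {W : MessageStructure m}
    {R : W.Rates} (h : W.RatesAchievable R) (σ : Equiv.Perm (Fin m)) :
    ∑ a, ∑ j ∈ chainDecoded W σ a, R a j ≤ 1 := by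
  obtain ⟨-, c, hc⟩ := h
  set S := ∑ a, ∑ j ∈ chainDecoded W σ a, R a j with hS
  by_contra! hlt
  have hlim : Tendsto (fun n => ∑ a, (c n).errorProb (upTo σ a)) atTop (𝓝 0) := by
    simpa using tendsto_finsetSum Finset.univ
      fun a _ => hc (upTo σ a) ⟨a, mem_upTo.2 le_rfl⟩
  have hgrow : Tendsto (fun n : ℕ => (n : ℝ) * (S - 1)) atTop atTop :=
    tendsto_natCast_atTop_atTop.atTop_mul_const (by linarith)
  obtain ⟨n, hn1, hn2⟩ := ((hlim.eventually_lt_const (show (0 : ℝ) < 1 / 2 by norm_num)).and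
    (hgrow.eventually_gt_atTop 1)).exists
  have h1 := (c n).one_sub_sum_errorProb_le σ
  have h2 := two_rpow_le_prod_msgCard R n (chainDecoded W σ)
  rw [← hS] at h2
  have h3 : (2 : ℝ) * 2 ^ n < 2 ^ ((n : ℝ) * S) := by
    rw [← Real.rpow_natCast, ← Real.rpow_one_add' (by norm_num) (by positivity)]
    exact Real.rpow_lt_rpow_of_exponent_lt (by norm_num) (by linarith)
  have h4 : (0 : ℝ) < 2 ^ n := by positivity
  nlinarith

theorem map_Iic_eq_upTo (σ : Equiv.Perm (Fin m)) (k : Fin m) :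
    (Finset.Iic k).map σ.toEmbedding = upTo σ.symm (σ k) := by
  ext b
  simp [mem_upTo]

theorem MessageStructure.RatesAchievable.rho_mem_polytope {W : MessageStructure m} {R : W.Rates} (h : W.RatesAchievable R) :
    rho (W.rateTuple R) ∈ polytope m := by
  have hF : (0 : ℝ) < Fintype.card (Equiv.Perm (Fin m)) := by exact_mod_cast Fintype.card_pos
  have hav : ∀ k : Fin m, normalized (rho (W.rateTuple R)) k =
      (∑ σ : Equiv.Perm (Fin m), (W.rateTuple R).ext ((Finset.Iic k).map σ.toEmbedding) (σ k)) /
        Fintype.card (Equiv.Perm (Fin m)) := fun k =>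
    normalized_rho_eq _ k (by simp) (by simp)
  refine ⟨fun k l hkl => ?_, fun k => ?_, ?_⟩
  · rw [hav k, normalized_rho_eq _ l (A := Finset.Iic l) (i := k) (by simp) (by simpa)]
    gcongr with σ
    have hsub : (Finset.Iic k).map σ.toEmbedding ⊆ (Finset.Iic l).map σ.toEmbedding :=
      Finset.map_subset_map.2 (Finset.Iic_subset_Iic.2 hkl)
    have hk : σ k ∈ (Finset.Iic k).map σ.toEmbedding := by simp
    rw [RateTuple.ext, RateTuple.ext, dif_pos hk, dif_pos (hsub hk)]
    exact Finset.sum_le_sum_of_subset_of_nonneg (W.decoded_anti _ _ hsub ⟨σ k, hk⟩)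
      fun j _ _ => h.1 _ _
  · rw [hav k]
    refine div_nonneg (Finset.sum_nonneg fun σ _ => ?_) hF.le
    rw [RateTuple.ext]
    split_ifs
    · exact Finset.sum_nonneg fun j _ => h.1 _ _
    · rfl
  · simp only [hav]
    rw [← Finset.sum_div, Finset.sum_comm, div_le_one hF]
    calc _ ≤ ∑ σ : Equiv.Perm (Fin m), (1 : ℝ) := Finset.sum_le_sum fun σ _ => ?_
      _ = _ := by simp
    refine le_trans (le_of_eq ?_) (h.sum_chainDecoded_le_one σ.symm)
    rw [← Equiv.sum_comp σ fun a => ∑ j ∈ chainDecoded W σ.symm a, R a j]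
    refine Finset.sum_congr rfl fun k _ => ?_
    rw [map_Iic_eq_upTo, RateTuple.ext, dif_pos (mem_upTo.2 le_rfl)]
    rfl

/-! ### Achievability -/

theorem eq_of_sum_pow_mul_eq {F ι : Type*} [Field F] {A : Finset ι} {K : ℕ} (hA : A.card ≤ K)
    {α : ι → F} (hα : Function.Injective α) {x y : ι → F}
    (h : ∀ t < K, ∑ a ∈ A, α a ^ t * x a = ∑ a ∈ A, α a ^ t * y a) {a : ι} (ha : a ∈ A) :
    x a = y a := by
  let e := A.equivFin.symm
  have h0 : (fun i => x (e i) - y (e i)) = 0 := by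
    refine Matrix.eq_zero_of_forall_pow_sum_mul_pow_eq_zero (f := fun i => α (e i))
      (hα.comp (Subtype.val_injective.comp e.injective)) fun t => ?_
    rw [Equiv.sum_comp e (fun a : A => (x a - y a) * α a ^ (t : ℕ)),
      Finset.sum_coe_sort A (fun a => (x a - y a) * α a ^ (t : ℕ))]
    simp only [mul_comm _ (α _ ^ _), mul_sub, Finset.sum_sub_distrib]
    exact sub_eq_zero.2 (h t (t.2.trans_le hA))
  have := congrFun h0 (e.symm ⟨a, ha⟩)
  simpa [sub_eq_zero] using this

/-- `m` codes of length `K * L`, each with `2 ^ L` codewords, such that the sum of the codewords of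
at most `K` of the codes determines the summands. -/
theorem exists_blockCode (K : ℕ) {L : ℕ} (hL : L ≠ 0) (hm : m ≤ 2 ^ L) :
    ∃ E : Fin m → Fin (2 ^ L) → Fin K × Fin L → ZMod 2, ∀ A : Finset (Fin m), A.card ≤ K →
      ∀ w w' : Fin m → Fin (2 ^ L), ∑ a ∈ A, E a (w a) = ∑ a ∈ A, E a (w' a) →
        ∀ a ∈ A, w a = w' a := by
  let F := GaloisField 2 L
  have : Fintype F := Fintype.ofFinite F
  have hF : Fintype.card F = 2 ^ L := by
    rw [← Nat.card_eq_fintype_card]; exact GaloisField.card 2 L hL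
  let φ : F ≃ₗ[ZMod 2] (Fin L → ZMod 2) :=
    (Module.finBasisOfFinrankEq (ZMod 2) F (GaloisField.finrank 2 hL)).equivFun
  let ι : Fin (2 ^ L) ≃ F := (Fintype.equivFinOfCardEq hF).symm
  let α : Fin m → F := fun a => ι (Fin.castLE hm a)
  have hα : Function.Injective α := ι.injective.comp (Fin.castLE_injective hm)
  refine ⟨fun a w p => φ (α a ^ (p.1 : ℕ) * ι w) p.2, fun A hA w w' h a ha => ?_⟩
  refine ι.injective (eq_of_sum_pow_mul_eq (x := fun a => ι (w a)) (y := fun a => ι (w' a)) hA hα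
    (fun t ht => φ.injective ?_) ha)
  funext l
  have := congrFun h (⟨t, ht⟩, l)
  simpa [Finset.sum_apply] using this

/-- The encoders `enc` are jointly injective: what a decoder has to decode is a function of what
it observes. -/
def Decodable (W : MessageStructure m) (R : W.Rates) (n : ℕ)
    (enc : (i : Fin m) → UserMsg W R n i → (Fin n → ZMod 2)) : Prop :=
  ∀ (A : Finset (Fin m)) (w w' : (i : Fin m) → UserMsg W R n i),
    (channelOut A fun a => enc a (w a)) = (channelOut A fun a => enc a (w' a)) →
      ∀ (i : A), ∀ j ∈ W.decoded A i, w i j = w' i j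

open Classical in
/-- The code with given encoders, whose decoders look for some messages that are consistent with
the observation. -/
noncomputable def codeOfEnc (W : MessageStructure m) (R : W.Rates) (n : ℕ)
    (enc : (i : Fin m) → UserMsg W R n i → (Fin n → ZMod 2)) : Code W R n where
  enc := enc
  dec A y i j :=
    if h : ∃ w : (i : Fin m) → UserMsg W R n i, (channelOut A fun a => enc a (w a)) = y then
      h.choose i j else 0

theorem Decodable.errorProb_eq_zero {W : MessageStructure m} {R : W.Rates} {n : ℕ}
    {enc : (i : Fin m) → UserMsg W R n i → (Fin n → ZMod 2)} (h : Decodable W R n enc)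
    (A : Finset (Fin m)) : (codeOfEnc W R n enc).errorProb A = 0 := by
  have : IsEmpty {w : (i : Fin m) → UserMsg W R n i // (codeOfEnc W R n enc).IsError A w} := by
    refine ⟨fun ⟨w, i, j, hne⟩ => hne ?_⟩
    have hex : ∃ w' : (i : Fin m) → UserMsg W R n i,
      (channelOut A fun a => enc a (w' a)) = channelOut A fun a => enc a (w a) := ⟨w, rfl⟩
    have hdec : (codeOfEnc W R n enc).dec A
        (channelOut A fun a => (codeOfEnc W R n enc).enc a (w a)) i j = hex.choose i j :=
      dif_pos hex
    rw [hdec]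
    exact h A _ _ hex.choose_spec i j j.2
  simp [Code.errorProb]

theorem ratesAchievable_of_decodable {W : MessageStructure m} {R : W.Rates}
    (hR : ∀ i j, 0 ≤ R i j) (h : ∀ᶠ n in atTop, ∃ enc, Decodable W R n enc) :
    W.RatesAchievable R := by
  classical
  refine ⟨hR, fun n => codeOfEnc W R n
    (if hn : ∃ enc, Decodable W R n enc then hn.choose else fun _ _ => 0), fun A _ => ?_⟩
  refine tendsto_const_nhds.congr' ?_
  filter_upwards [h] with n hn
  rw [dif_pos hn, hn.choose_spec.errorProb_eq_zero]

/-- The rates in the layered message structure that are the same for all users. -/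
def layerRates (s : Fin m → ℝ) : (layered m).Rates := fun _ j => s j

theorem mem_layered_decoded {A : Finset (Fin m)} {i : A} {j : Fin m} :
    j ∈ (layered m).decoded A i ↔ A.card ≤ (j : ℕ) + 1 :=
  Finset.mem_filter_univ j

theorem exists_decodable_layerRates {s : Fin m → ℝ} {n : ℕ} {L : Fin m → ℕ} (hL0 : ∀ j, L j ≠ 0)
    (hLm : ∀ j, m ≤ 2 ^ L j) (hLs : ∀ j, msgCard n (s j) ≤ 2 ^ L j)
    (hn : ∑ j : Fin m, ((j : ℕ) + 1) * L j ≤ n) :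
    ∃ enc, Decodable (layered m) (layerRates s) n enc := by
  choose E hE using fun j : Fin m => exists_blockCode ((j : ℕ) + 1) (hL0 j) (hLm j)
  obtain ⟨e⟩ : Nonempty ((Σ j : Fin m, Fin ((j : ℕ) + 1) × Fin (L j)) ↪ Fin n) :=
    Function.Embedding.nonempty_of_card_le (by simpa using hn)
  refine ⟨fun i w => Function.extend e (fun p => E p.1 i (Fin.castLE (hLs p.1) (w p.1)) p.2) 0,
    fun A w w' h i j hj => ?_⟩
  have hj' : A.card ≤ (j : ℕ) + 1 := mem_layered_decoded.1 hj
  refine Fin.castLE_injective (hLs j) (hE j A hj' (fun a => Fin.castLE (hLs j) (w a j))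
    (fun a => Fin.castLE (hLs j) (w' a j)) ?_ i i.2)
  funext p
  have := congrFun h (e ⟨j, p⟩)
  simpa [channelOut, e.injective.extend_apply, Finset.sum_apply] using this

theorem msgCard_le_two_pow {n : ℕ} {s : ℝ} {L : ℕ} (h : n * s ≤ L) : msgCard n s ≤ 2 ^ L := by
  rw [msgCard, Nat.ceil_le]
  push_cast
  rw [← Real.rpow_natCast]
  exact Real.rpow_le_rpow_of_exponent_le (by norm_num) h

theorem ratesAchievable_layerRates {s : Fin m → ℝ} (hs : ∀ j, 0 ≤ s j)
    (hsum : ∑ j : Fin m, ((j : ℕ) + 1 : ℝ) * s j < 1) :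
    (layered m).RatesAchievable (layerRates s) := by
  refine ratesAchievable_of_decodable (fun i j => hs j) ?_
  have hgrow : Tendsto
      (fun n : ℕ => (n : ℝ) * (1 - ∑ j : Fin m, ((j : ℕ) + 1 : ℝ) * s j)) atTop atTop :=
    tendsto_natCast_atTop_atTop.atTop_mul_const (by linarith)
  filter_upwards [hgrow.eventually_ge_atTop (∑ j : Fin m, ((j : ℕ) + 1 : ℝ) * (m + 2))] with n hn
  refine exists_decodable_layerRates (L := fun j => ⌈n * s j⌉₊ + (m + 1)) (fun j => by omega)
    (fun j => ?_) (fun j => msgCard_le_two_pow ?_) ?_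
  · exact Nat.lt_two_pow_self.le.trans (Nat.pow_le_pow_right two_pos (by omega))
  · push_cast
    have := Nat.le_ceil (n * s j)
    have : (0 : ℝ) ≤ m := Nat.cast_nonneg _
    linarith
  · have : ∀ j : Fin m, ((((j : ℕ) + 1) * (⌈n * s j⌉₊ + (m + 1)) : ℕ) : ℝ) ≤
        n * (((j : ℕ) + 1 : ℝ) * s j) + ((j : ℕ) + 1 : ℝ) * (m + 2) := by
      intro j
      have := (Nat.ceil_lt_add_one (mul_nonneg (Nat.cast_nonneg n) (hs j))).le
      push_cast
      nlinarith [(Nat.cast_nonneg (j : ℕ) : (0 : ℝ) ≤ _)]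
    have h2 := Finset.sum_le_sum fun (j : Fin m) (_ : j ∈ Finset.univ) => this j
    rw [Finset.sum_add_distrib, ← Finset.mul_sum] at h2
    have h3 : ((∑ j : Fin m, ((j : ℕ) + 1) * (⌈n * s j⌉₊ + (m + 1)) : ℕ) : ℝ) ≤ n := by
      rw [Nat.cast_sum]
      linarith
    exact_mod_cast h3

theorem continuous_rateTuple_layerRates :
    Continuous fun s : Fin m → ℝ => (layered m).rateTuple (layerRates s) := by
  unfold MessageStructure.rateTuple layerRates
  fun_prop

theorem rateTuple_layerRates_mem {s : Fin m → ℝ} (hs : ∀ j, 0 ≤ s j)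
    (hsum : ∑ j : Fin m, ((j : ℕ) + 1 : ℝ) * s j ≤ 1) :
    (layered m).rateTuple (layerRates s) ∈ (layered m).capacityRegion := by
  have hlim : Tendsto (fun t : ℝ => (layered m).rateTuple (layerRates (t • s))) (𝓝[<] 1)
      (𝓝 ((layered m).rateTuple (layerRates s))) := by
    have : Continuous fun t : ℝ => (layered m).rateTuple (layerRates (t • s)) :=
      continuous_rateTuple_layerRates.comp (by fun_prop)
    simpa using (this.tendsto 1).mono_left nhdsWithin_le_nhds
  refine mem_closure_of_tendsto hlim ?_
  filter_upwards [Ioo_mem_nhdsLT (show (0 : ℝ) < 1 by norm_num)] with t ht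
  refine ⟨_, ratesAchievable_layerRates (fun j => mul_nonneg ht.1.le (hs j)) ?_, rfl⟩
  have : ∑ j : Fin m, ((j : ℕ) + 1 : ℝ) * (t * s j) =
      t * ∑ j : Fin m, ((j : ℕ) + 1 : ℝ) * s j := by
    rw [Finset.mul_sum]
    exact Finset.sum_congr rfl fun j _ => by ring
  rw [this]
  nlinarith [ht.1, ht.2]

/-! ### The polytope -/

theorem normalized_denom_pos (k : Fin m) :
    (0 : ℝ) < ((k : ℕ) + 1 : ℝ) * (m.choose ((k : ℕ) + 1) : ℝ) := by
  have : 0 < m.choose ((k : ℕ) + 1) := Nat.choose_pos k.2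
  positivity

theorem normalized_injective : Function.Injective (normalized (m := m)) := fun ρ ρ' h => by
  funext k
  exact (div_left_inj' (normalized_denom_pos k).ne').1 (congrFun h k)

theorem normalized_sum_smul {ι : Type*} (t : Finset ι) (w : ι → ℝ) (v : ι → Fin m → ℝ)
    (l : Fin m) : normalized (∑ k ∈ t, w k • v k) l = ∑ k ∈ t, w k * normalized (v k) l := by
  simp [normalized, Finset.sum_apply, Finset.sum_div, mul_div_assoc]

theorem normalized_add_smul (a b : ℝ) (ρ ρ' : Fin m → ℝ) (k : Fin m) :
    normalized (a • ρ + b • ρ') k = a * normalized ρ k + b * normalized ρ' k := by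
  simp [normalized, add_div, mul_div_assoc]

theorem convex_polytope : Convex ℝ (polytope m) := by
  rintro ρ ⟨h1, h2, h3⟩ ρ' ⟨h1', h2', h3'⟩ a b ha hb hab
  refine ⟨fun k l hkl => ?_, fun k => ?_, ?_⟩
  · simp only [normalized_add_smul]
    exact add_le_add (mul_le_mul_of_nonneg_left (h1 hkl) ha)
      (mul_le_mul_of_nonneg_left (h1' hkl) hb)
  · rw [normalized_add_smul]
    exact add_nonneg (mul_nonneg ha (h2 k)) (mul_nonneg hb (h2' k))
  · simp only [normalized_add_smul, Finset.sum_add_distrib, ← Finset.mul_sum]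
    nlinarith

theorem continuous_normalized : Continuous (normalized (m := m)) := by
  unfold normalized
  fun_prop

theorem isClosed_polytope : IsClosed (polytope m) := by
  have hc : ∀ k, Continuous fun ρ : Fin m → ℝ => normalized ρ k := fun k =>
    (continuous_apply k).comp continuous_normalized
  simp only [polytope, Antitone, Set.ofPred_and, Set.ofPred_forall]
  refine (isClosed_iInter fun k => isClosed_iInter fun l => isClosed_iInter fun _ =>
    isClosed_le (hc l) (hc k)).inter ((isClosed_iInter fun k =>
    isClosed_le continuous_const (hc k)).inter
    (isClosed_le (continuous_finsetSum _ fun k _ => hc k) continuous_const))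

theorem continuous_rho : Continuous (rho (m := m)) := by
  unfold rho
  fun_prop

theorem normalized_rho_layerRates (s : Fin m → ℝ) (l : Fin m) :
    normalized (rho ((layered m).rateTuple (layerRates s))) l = ∑ j ∈ Finset.Ici l, s j := by
  have h : ∀ p ∈ pointedSets m (l + 1),
      ((layered m).rateTuple (layerRates s)).ext p.1 p.2 = ∑ j ∈ Finset.Ici l, s j := by
    rintro ⟨A, i⟩ hp
    simp only [pointedSets, Finset.mem_filter, Finset.mem_univ, true_and] at hp
    rw [RateTuple.ext, dif_pos hp.2]
    refine Finset.sum_congr (Finset.ext fun (j : Fin m) => ?_) fun _ _ => rfl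
    have hj : A.card ≤ (j : ℕ) + 1 ↔ j ∈ Finset.Ici l := by
      rw [hp.1, Finset.mem_Ici, Fin.le_def, Nat.add_le_add_iff_right]
    exact mem_layered_decoded.trans hj
  have hc := card_pointedSets m (l + 1)
  push_cast at hc
  rw [normalized, rho_eq_sum, Finset.sum_congr rfl h, Finset.sum_const, nsmul_eq_mul, hc,
    mul_div_cancel_left₀ _ (normalized_denom_pos l).ne']

theorem sum_sum_Ici (s : Fin m → ℝ) :
    ∑ l : Fin m, ∑ j ∈ Finset.Ici l, s j = ∑ j : Fin m, ((j : ℕ) + 1 : ℝ) * s j := by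
  rw [Finset.sum_comm' (t' := Finset.univ) (s' := fun j => Finset.Iic j) (by simp)]
  simp

theorem rho_layerRates_mem_polytope {s : Fin m → ℝ} (hs : ∀ j, 0 ≤ s j)
    (hsum : ∑ j : Fin m, ((j : ℕ) + 1 : ℝ) * s j ≤ 1) :
    rho ((layered m).rateTuple (layerRates s)) ∈ polytope m := by
  refine ⟨fun k l hkl => ?_, fun k => ?_, ?_⟩
  · simp only [normalized_rho_layerRates]
    exact Finset.sum_le_sum_of_subset_of_nonneg (Finset.Ici_subset_Ici.2 hkl) fun j _ _ => hs j
  · rw [normalized_rho_layerRates]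
    exact Finset.sum_nonneg fun j _ => hs j
  · simpa only [normalized_rho_layerRates, sum_sum_Ici] using hsum

theorem exists_layerRates {ρ : Fin m → ℝ} (h : ρ ∈ polytope m) :
    ∃ s : Fin m → ℝ, (∀ j, 0 ≤ s j) ∧ ∑ j : Fin m, ((j : ℕ) + 1 : ℝ) * s j ≤ 1 ∧
      rho ((layered m).rateTuple (layerRates s)) = ρ := by
  obtain ⟨h1, h2, h3⟩ := h
  let y : ℕ → ℝ := fun j => if hj : j < m then normalized ρ ⟨j, hj⟩ else 0
  have hy : ∀ j : Fin m, y j = normalized ρ j := fun j => dif_pos j.2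
  let s : Fin m → ℝ := fun j => y j - y (j + 1)
  have hsum : ∀ l : Fin m, ∑ j ∈ Finset.Ici l, s j = normalized ρ l := by
    intro l
    have : ∑ j ∈ Finset.Ici l, s j = ∑ j ∈ Finset.Ico (l : ℕ) m, (y j - y (j + 1)) := by
      rw [← Fin.map_valEmbedding_Ici, Finset.sum_map]
      rfl
    have hneg := Finset.sum_Ico_sub y l.2.le
    have hm : y m = 0 := dif_neg (lt_irrefl m)
    rw [← hy l, this]
    rw [hm, ← neg_inj, ← Finset.sum_neg_distrib] at hneg
    simpa using hneg
  refine ⟨s, fun j => ?_, ?_, normalized_injective (funext fun l => ?_)⟩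
  · refine sub_nonneg.2 ?_
    rw [hy]
    by_cases hj : (j : ℕ) + 1 < m
    · simp only [y, dif_pos hj]
      exact h1 (Fin.le_def.2 (Nat.le_succ _))
    · simp only [y, dif_neg hj]
      exact h2 j
  · simpa only [← sum_sum_Ici, hsum] using h3
  · rw [normalized_rho_layerRates, hsum]

theorem singleLayerRates_eq (k : Fin m) (t : ℝ) :
    singleLayerRates m k t = layerRates (Pi.single k t) := by
  funext i (j : Fin m)
  refine Eq.trans ?_ (Pi.single_apply k t j).symm
  simp only [singleLayerRates, Fin.ext_iff]

theorem sum_mul_single (k : Fin m) (t : ℝ) :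
    ∑ j : Fin m, ((j : ℕ) + 1 : ℝ) * (Pi.single k t : Fin m → ℝ) j = ((k : ℕ) + 1 : ℝ) * t := by
  simp [Pi.single_apply]

theorem single_nonneg {k : Fin m} {t : ℝ} (ht : 0 ≤ t) (j : Fin m) :
    0 ≤ (Pi.single k t : Fin m → ℝ) j := by
  rw [Pi.single_apply]; split_ifs <;> simp [ht]

theorem sum_mul_single_inv (k : Fin m) :
    ∑ j : Fin m, ((j : ℕ) + 1 : ℝ) *
      (Pi.single k (1 / ((k : ℕ) + 1 : ℝ)) : Fin m → ℝ) j ≤ 1 := by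
  rw [sum_mul_single, mul_one_div_cancel (by positivity)]

theorem rho_layerRates_eq_sum (s : Fin m → ℝ) :
    rho ((layered m).rateTuple (layerRates s)) = ∑ k : Fin m, (((k : ℕ) + 1 : ℝ) * s k) •
      rho ((layered m).rateTuple (singleLayerRates m k (1 / ((k : ℕ) + 1 : ℝ)))) := by
  refine normalized_injective (funext fun l => ?_)
  rw [normalized_sum_smul]
  simp only [singleLayerRates_eq, normalized_rho_layerRates, Pi.single_apply, Finset.sum_ite_eq']
  rw [← Finset.sum_filter_add_sum_filter_not Finset.univ (fun k => k ∈ Finset.Ici l),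
    Finset.filter_mem_eq_inter, Finset.univ_inter, Finset.sum_eq_zero (s := Finset.filter _ _),
    add_zero]
  · refine Finset.sum_congr rfl fun k hk => ?_
    rw [if_pos hk]
    field_simp
  · intro k hk
    rw [if_neg (Finset.mem_filter.1 hk).2, mul_zero]

theorem polytope_eq_convexHull :
    polytope m = convexHull ℝ (insert 0 (Set.range fun k : Fin m =>
      rho ((layered m).rateTuple (singleLayerRates m k (1 / ((k : ℕ) + 1 : ℝ)))))) := by
  refine Set.Subset.antisymm (fun ρ hρ => ?_) (convexHull_min ?_ convex_polytope)
  · obtain ⟨s, hs, hsum, rfl⟩ := exists_layerRates hρ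
    rw [rho_layerRates_eq_sum]
    have h := (convex_convexHull ℝ (insert 0 (Set.range fun k : Fin m =>
      rho ((layered m).rateTuple (singleLayerRates m k (1 / ((k : ℕ) + 1 : ℝ))))))).sum_mem
      (t := Finset.univ)
      (w := fun o : Option (Fin m) => o.elim (1 - ∑ j : Fin m, ((j : ℕ) + 1 : ℝ) * s j)
        fun k => ((k : ℕ) + 1 : ℝ) * s k)
      (z := fun o => o.elim 0
        fun k => rho ((layered m).rateTuple (singleLayerRates m k (1 / ((k : ℕ) + 1 : ℝ)))))
      ?_ ?_ ?_
    · simpa [Fintype.sum_option] using h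
    · rintro (_ | k) -
      · simpa using hsum
      · exact mul_nonneg (by positivity) (hs k)
    · simp [Fintype.sum_option]
    · rintro (_ | k) -
      · exact subset_convexHull _ _ (Set.mem_insert _ _)
      · exact subset_convexHull _ _ (Set.mem_insert_of_mem _ ⟨k, rfl⟩)
  · refine Set.insert_subset ?_ ?_
    · simp [polytope, normalized, Antitone]
    · rintro _ ⟨k, rfl⟩
      simp only [singleLayerRates_eq]
      exact rho_layerRates_mem_polytope (single_nonneg (by positivity)) (sum_mul_single_inv k)

theorem MessageStructure.capacityRegion_subset (W : MessageStructure m) :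
    W.capacityRegion ⊆ rho ⁻¹' polytope m := by
  refine closure_minimal ?_ (isClosed_polytope.preimage continuous_rho)
  rintro _ ⟨R, hR, rfl⟩
  exact hR.rho_mem_polytope

theorem capacityRegion_subset : capacityRegion m ⊆ rho ⁻¹' polytope m :=
  closure_minimal (Set.iUnion_subset fun W => W.capacityRegion_subset)
    (isClosed_polytope.preimage continuous_rho)

theorem MessageStructure.capacityRegion_subset_capacityRegion (W : MessageStructure m) :
    W.capacityRegion ⊆ BDRAC.capacityRegion m :=
  (Set.subset_iUnion (fun W : MessageStructure m => W.capacityRegion) W).trans subset_closure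

theorem polytope_subset_image :
    polytope m ⊆ rho '' (layered m).capacityRegion := fun ρ hρ => by
  obtain ⟨s, hs, hsum, rfl⟩ := exists_layerRates hρ
  exact ⟨_, rateTuple_layerRates_mem hs hsum, rfl⟩

end BDRAC

theorem mainTheorem3 (m : ℕ) (hm : 2 ≤ m) :
    BDRAC.rho '' BDRAC.capacityRegion m = BDRAC.polytope m ∧
    BDRAC.rho '' (BDRAC.layered m).capacityRegion = BDRAC.polytope m ∧
    (∀ (k : Fin m) (s : ℝ), 0 ≤ s → s < 1 / ((k : ℕ) + 1 : ℝ) →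
      (BDRAC.layered m).RatesAchievable (BDRAC.singleLayerRates m k s)) ∧
    (∀ k : Fin m,
      (BDRAC.layered m).rateTuple (BDRAC.singleLayerRates m k (1 / ((k : ℕ) + 1 : ℝ))) ∈
        (BDRAC.layered m).capacityRegion) ∧
    BDRAC.polytope m = convexHull ℝ (insert 0 (Set.range fun k : Fin m =>
      BDRAC.rho ((BDRAC.layered m).rateTuple
        (BDRAC.singleLayerRates m k (1 / ((k : ℕ) + 1 : ℝ)))))) := by
  refine ⟨Set.Subset.antisymm (Set.image_subset_iff.2 BDRAC.capacityRegion_subset) ?_,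
    Set.Subset.antisymm (Set.image_subset_iff.2 (BDRAC.layered m).capacityRegion_subset)
      BDRAC.polytope_subset_image, fun k s hs hlt => ?_, fun k => ?_,
    BDRAC.polytope_eq_convexHull⟩
  · exact BDRAC.polytope_subset_image.trans
      (Set.image_mono (BDRAC.layered m).capacityRegion_subset_capacityRegion)
  · rw [BDRAC.singleLayerRates_eq]
    refine BDRAC.ratesAchievable_layerRates (BDRAC.single_nonneg hs) ?_
    rw [BDRAC.sum_mul_single, mul_comm]
    exact (lt_div_iff₀ (by positivity)).1 hlt
  · rw [BDRAC.singleLayerRates_eq]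
    exact BDRAC.rateTuple_layerRates_mem (BDRAC.single_nonneg (by positivity))
      (BDRAC.sum_mul_single_inv k)
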